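/- Let $n$ and $r$ be positive integers. For each $i\in[n]=\{1,\dots,n\}$ take two $r$-element sets $D^+[i]$ and $D^-[i]$, all $2n$ of these sets being pairwise disjoint, and choose uniformly at random a perfect matching (bijection) between $D^+=\bigcup_{i=1}^n D^+[i]$ and $D^-=\bigcup_{i=1}^n D^-[i]$. Let $D^*(n,r)$ be the resulting random multidigraph on the vertex set $[n]$, which has one arc from $i$ to $j$ for each element of $D^+[i]$ that is matched with an element of $D^-[j]$. An oriented (simple) graph is a digraph without loops, parallel arcs, or digons (directed cycles of length two). **Lemma.** Fix a positive integer $r$ and, for every positive integer $i$, let $\mu_i=\dfrac{(2r-1)^i+1}{2i}$. Then $$\lim_{n\to\infty}\mathbb P\bigl(D^*(n,r)\text{ is an oriented (simple) graph}\bigr)=e^{-\mu_1-\mu_2}.$$ -/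

import Mathlib

open Filter Topology MeasureTheory

/-- A multidigraph with vertex set `V`, parallel arcs being indistinguishable and loops being
allowed: `mult i j` is the number of arcs from `i` to `j`. -/
@[ext]
structure Multidigraph (V : Type) where
  mult : V → V → ℕ

namespace Multidigraph

/-- No loops. -/
def Loopless {V : Type} (D : Multidigraph V) : Prop :=
  ∀ i, D.mult i i = 0

/-- No parallel arcs (two or more arcs with the same tail and the same head). -/
def NoParallelArcs {V : Type} (D : Multidigraph V) : Prop :=
  ∀ i j, D.mult i j ≤ 1

/-- A multidigraph is simple if it has no loops and no parallel arcs. -/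
def IsSimple {V : Type} (D : Multidigraph V) : Prop :=
  D.Loopless ∧ D.NoParallelArcs

/-- No digons (directed cycles of length two). -/
def DigonFree {V : Type} (D : Multidigraph V) : Prop :=
  ∀ i j, i ≠ j → ¬ (0 < D.mult i j ∧ 0 < D.mult j i)

/-- An oriented (simple) graph: a simple digraph without digons. -/
def IsOrientedGraph {V : Type} (D : Multidigraph V) : Prop :=
  D.IsSimple ∧ D.DigonFree

/-- Every set of multidigraphs is an event. -/
instance {V : Type} : MeasurableSpace (Multidigraph V) := ⊤

end Multidigraph

/-- The set `D⁺`, the disjoint union of the `r`-sets `D⁺[i] = {(i, k) | k}`, for `i` in `[n]`. -/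
abbrev OutPoint (n r : ℕ) : Type := Fin n × Fin r

/-- The set `D⁻`, the disjoint union of the `r`-sets `D⁻[i] = {(i, k) | k}`, for `i` in `[n]`. -/
abbrev InPoint (n r : ℕ) : Type := Fin n × Fin r

/-- A directed configuration: a pairing between the elements of `D⁺` and those of `D⁻`. -/
abbrev DirectedConfiguration (n r : ℕ) : Type := OutPoint n r ≃ InPoint n r

/-- The multidigraph of a directed configuration: there is one arc `ij` for each
`u ∈ D⁺[i]` that is paired with some `v ∈ D⁻[j]`. -/
def DirectedConfiguration.toMultidigraph {n r : ℕ} (c : DirectedConfiguration n r) :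
    Multidigraph (Fin n) where
  mult i j := (Finset.univ.filter (fun u : OutPoint n r => u.1 = i ∧ (c u).1 = j)).card

/-- The directed configuration model `D*(n,r)`: the law of the multidigraph of a uniformly
random directed configuration. -/
noncomputable def directedConfigurationModel (n r : ℕ) : PMF (Multidigraph (Fin n)) :=
  (PMF.uniformOfFintype (DirectedConfiguration n r)).map DirectedConfiguration.toMultidigraph

/-- `μ_i = ((2r - 1)^i + 1) / (2i)`, for `i ≥ 1`; the subtraction is in `ℝ`. -/
noncomputable def cycleMean (r i : ℕ) : ℝ :=
  ((2 * (r : ℝ) - 1) ^ i + 1) / (2 * (i : ℝ))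

/-
Count loops, parallel pairs and digons as a statistic of a uniformly random permutation, and apply
the Stein-Chen method. Switching the heads of two arcs plants a given loop, or the second arc of a
given forbidden pair, in an otherwise uniform permutation, and up to an error of order `1 / n` in
expectation it adds exactly one forbidden structure. Hence `W`, twice the number of forbidden
structures, satisfies `𝔼 W f(W) ≈ lam 𝔼 f(W + 2)` for all `f` with values in `[0, 1]`. Taking for
`f` the bounded solution of `k f(k) - lam f(k + 2) = exp (-lam / 2) - 1_{k = 0}` gives
`ℙ(W = 0) ≈ exp (-lam / 2)`.
-/

open scoped BigOperators

/-- The solution of the Stein equation of twice a Poisson variable `Z` of mean `lam / 2`, for the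
event `Z = 0`. At `k = 0` the truncated exponent gives a junk value, which the factor `k` in the
Stein equation cancels. -/
noncomputable def steinSolution (lam : ℝ) (k : ℕ) : ℝ :=
  ∫ t in (0 : ℝ)..1, t ^ (k - 1) * Real.exp (-(lam / 2) * t ^ 2)

lemma steinSolution_nonneg (lam : ℝ) (k : ℕ) : 0 ≤ steinSolution lam k :=
  intervalIntegral.integral_nonneg zero_le_one fun _ ht =>
    mul_nonneg (pow_nonneg ht.1 _) (Real.exp_pos _).le

lemma steinSolution_le_one {lam : ℝ} (hlam : 0 ≤ lam) (k : ℕ) : steinSolution lam k ≤ 1 := by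
  have hle : ∀ t ∈ Set.Icc (0 : ℝ) 1, t ^ (k - 1) * Real.exp (-(lam / 2) * t ^ 2) ≤ 1 :=
    fun t ht => mul_le_one₀ (pow_le_one₀ ht.1 ht.2) (Real.exp_pos _).le
      (Real.exp_le_one_iff.2 (by nlinarith [sq_nonneg t]))
  have hcont : Continuous fun t : ℝ => t ^ (k - 1) * Real.exp (-(lam / 2) * t ^ 2) := by fun_prop
  simpa [steinSolution] using intervalIntegral.integral_mono_on zero_le_one
    (hcont.intervalIntegrable 0 1) (intervalIntegrable_const (μ := volume) (c := (1 : ℝ))) hle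

/-- Integrate the derivative of `t ^ k * exp (-(lam / 2) * t ^ 2)` over `[0, 1]`. -/
lemma stein_equation (lam : ℝ) (k : ℕ) :
    k * steinSolution lam k - lam * steinSolution lam (k + 2) =
      Real.exp (-(lam / 2)) - if k = 0 then 1 else 0 := by
  have hderiv : ∀ t : ℝ, HasDerivAt (fun t : ℝ => t ^ k * Real.exp (-(lam / 2) * t ^ 2))
      (k * (t ^ (k - 1) * Real.exp (-(lam / 2) * t ^ 2)) -
        lam * (t ^ (k + 1) * Real.exp (-(lam / 2) * t ^ 2))) t := fun t =>
    ((hasDerivAt_pow k t).mul (((hasDerivAt_pow 2 t).const_mul (-(lam / 2))).exp)).congr_deriv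
      (by push_cast; ring)
  have hintegrable : ∀ (a : ℝ) (m : ℕ), IntervalIntegrable
      (fun t : ℝ => a * (t ^ m * Real.exp (-(lam / 2) * t ^ 2))) volume 0 1 := fun a m =>
    (by fun_prop : Continuous fun t : ℝ =>
      a * (t ^ m * Real.exp (-(lam / 2) * t ^ 2))).intervalIntegrable 0 1
  have hftc := intervalIntegral.integral_eq_sub_of_hasDerivAt (fun t _ => hderiv t)
    ((hintegrable _ _).sub (hintegrable _ _))
  rw [intervalIntegral.integral_sub (hintegrable _ _) (hintegrable _ _),
    intervalIntegral.integral_const_mul, intervalIntegral.integral_const_mul] at hftc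
  simpa [steinSolution, zero_pow_eq] using hftc

lemma abs_sum_le_sum {ι M : Type*} [AddCommGroup M] [LinearOrder M] [IsOrderedAddMonoid M]
    {s : Finset ι} {f g : ι → M} (h : ∀ i ∈ s, |f i| ≤ g i) :
    |∑ i ∈ s, f i| ≤ ∑ i ∈ s, g i :=
  (Finset.abs_sum_le_sum_abs f s).trans (Finset.sum_le_sum h)

section Switching

variable {Ω M : Type*} [Fintype Ω] [DecidableEq Ω]

lemma expect_mul_swap [AddCommMonoid M] [Module ℚ≥0 M] (u x : Ω) (H : Equiv.Perm Ω → M) :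
    𝔼 c, H (c * Equiv.swap u x) = 𝔼 c, H c :=
  Fintype.expect_equiv (Equiv.mulRight (Equiv.swap u x)) _ _ fun _ => rfl

lemma expect_sum_sum_mul_swap [AddCommMonoid M] [Module ℚ≥0 M]
    (H : Equiv.Perm Ω → Ω → Ω → M) :
    𝔼 c, ∑ u, ∑ x, H (c * Equiv.swap u x) u x = 𝔼 c, ∑ u, ∑ x, H c u x := by
  simp only [Finset.expect_sum_comm]
  exact Finset.sum_congr rfl fun u _ => Finset.sum_congr rfl fun x _ =>
    expect_mul_swap u x fun c => H c u x

end Switching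

/-- A family of forbidden arcs `(u, v)` and of forbidden pairs of arcs `(u, v)`, `(u', v')`, given
by their indicators. Every point is on `r` forbidden arcs in either direction, and every
arc that is not itself forbidden is in `d` forbidden pairs; given a permutation `c`, at most `K`
arcs with a given tail, or with a given head, form a forbidden pair with some arc of `c`, counted
with multiplicity. -/
structure ForbiddenPattern (Ω : Type*) [Fintype Ω] (r d K : ℕ) where
  arc : Ω → Ω → ℕ
  pair : Ω → Ω → Ω → Ω → ℕ
  arc_le_one : ∀ u v, arc u v ≤ 1
  pair_le_one : ∀ u v u' v', pair u v u' v' ≤ 1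
  sum_arc_right : ∀ u, ∑ v, arc u v = r
  sum_arc_left : ∀ v, ∑ u, arc u v = r
  pair_comm : ∀ u v u' v', pair u v u' v' = pair u' v' u v
  pair_eq_zero_of_arc : ∀ u v u' v', arc u v ≠ 0 → pair u v u' v' = 0
  pair_same_tail : ∀ u v v', pair u v u v' = 0
  pair_same_head : ∀ u v u', pair u v u' v = 0
  sum_pair : ∀ u v, arc u v = 0 → ∑ u', ∑ v', pair u v u' v' = d
  sum_pair_tail_le : ∀ (c : Equiv.Perm Ω) w, ∑ u, ∑ v, pair u (c u) w v ≤ K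
  sum_pair_head_le : ∀ (c : Equiv.Perm Ω) v, ∑ u, ∑ w, pair u (c u) w v ≤ K

namespace ForbiddenPattern

variable {Ω : Type*} [Fintype Ω] {r d K : ℕ} (S : ForbiddenPattern Ω r d K)

/-- The number of forbidden arcs of `c`. -/
def arcCount (c : Equiv.Perm Ω) : ℕ := ∑ u, S.arc u (c u)

/-- The number of forbidden pairs of arcs of `c` that contain the arc with tail `u`. -/
def pairDegree (c : Equiv.Perm Ω) (u : Ω) : ℕ := ∑ w, S.pair u (c u) w (c w)

/-- The number of forbidden pairs of arcs of `c`, the pairs being ordered. -/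
def pairCount (c : Equiv.Perm Ω) : ℕ := ∑ u, S.pairDegree c u

/-- Twice the number of forbidden arcs and pairs of arcs of `c` with all tails in `s`. The factor
`2` spares a division, as pairs are counted in both orders. -/
def weightOn (c : Equiv.Perm Ω) (s : Finset Ω) : ℕ :=
  2 * ∑ u ∈ s, S.arc u (c u) + ∑ u ∈ s, ∑ w ∈ s, S.pair u (c u) w (c w)

/-- Twice the number of forbidden arcs and pairs of arcs of `c`. -/
def weight (c : Equiv.Perm Ω) : ℕ := S.weightOn c Finset.univ

/-- The part of the weight of `c` that is due to the arc with tail `u`. -/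
def load (c : Equiv.Perm Ω) (u : Ω) : ℕ := 2 * S.arc u (c u) + 2 * S.pairDegree c u

lemma weight_eq (c : Equiv.Perm Ω) : S.weight c = 2 * S.arcCount c + S.pairCount c := rfl

lemma arcCount_le_weight (c : Equiv.Perm Ω) : S.arcCount c ≤ S.weight c := by
  rw [weight_eq]; lia

lemma pairCount_le_weight (c : Equiv.Perm Ω) : S.pairCount c ≤ S.weight c := by
  rw [weight_eq]; lia

lemma sum_load_le (c : Equiv.Perm Ω) : ∑ u, S.load c u ≤ 2 * S.weight c := by
  simp only [load, weight_eq, arcCount, pairCount, Finset.sum_add_distrib, ← Finset.mul_sum]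
  lia

lemma pair_le_pairDegree (c : Equiv.Perm Ω) (u x : Ω) :
    S.pair u (c u) x (c x) ≤ S.pairDegree c u :=
  Finset.single_le_sum (f := fun w => S.pair u (c u) w (c w)) (fun _ _ => Nat.zero_le _)
    (Finset.mem_univ x)

lemma sum_pair_le (u v : Ω) : ∑ u', ∑ v', S.pair u v u' v' ≤ d := by
  by_cases h : S.arc u v = 0
  · exact (S.sum_pair u v h).le
  · simp [S.pair_eq_zero_of_arc u v _ _ h]

lemma pairDegree_le (c : Equiv.Perm Ω) (u : Ω) : S.pairDegree c u ≤ d :=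
  (Finset.sum_le_sum fun w _ => Finset.single_le_sum (f := fun y => S.pair u (c u) w y)
    (fun _ _ => Nat.zero_le _) (Finset.mem_univ (c w))).trans (S.sum_pair_le u (c u))

lemma load_le (c : Equiv.Perm Ω) (u : Ω) : S.load c u ≤ 2 + 2 * d := by
  have harc := S.arc_le_one u (c u)
  have hpair := S.pairDegree_le c u
  unfold load
  lia

lemma sum_arc_mul_left (c : Equiv.Perm Ω) (g : Ω → ℝ) :
    ∑ u, ∑ x, (S.arc u (c x) : ℝ) * g u = r * ∑ u, g u := by
  have hsum : ∀ u, ∑ x, (S.arc u (c x) : ℝ) = r := fun u =>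
    (Equiv.sum_comp c fun v => (S.arc u v : ℝ)).trans (by exact_mod_cast S.sum_arc_right u)
  simp only [← Finset.sum_mul, hsum, Finset.mul_sum]

lemma sum_arc_mul_right (c : Equiv.Perm Ω) (g : Ω → ℝ) :
    ∑ u, ∑ x, (S.arc u (c x) : ℝ) * g x = r * ∑ x, g x := by
  rw [Finset.sum_comm]
  simp only [← Finset.sum_mul, ← Nat.cast_sum, S.sum_arc_left, Finset.mul_sum]

lemma sum_sum_pair (c : Equiv.Perm Ω) (u : Ω) :
    ∑ w, ∑ x, (S.pair u (c u) w (c x) : ℝ) = d * (1 - S.arc u (c u)) := by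
  have hsum : ∀ w, ∑ x, (S.pair u (c u) w (c x) : ℝ) = ∑ v, (S.pair u (c u) w v : ℝ) :=
    fun w => Equiv.sum_comp c fun v => (S.pair u (c u) w v : ℝ)
  simp only [hsum, ← Nat.cast_sum]
  rcases Nat.le_one_iff_eq_zero_or_eq_one.1 (S.arc_le_one u (c u)) with h | h
  · simp [S.sum_pair _ _ h, h]
  · simp [S.pair_eq_zero_of_arc u (c u) _ _ (by simp [h]), h]

lemma sum_pair_mul_const (c : Equiv.Perm Ω) (a : ℝ) :
    ∑ u, ∑ w, ∑ x, (S.pair u (c u) w (c x) : ℝ) * a =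
      d * (Fintype.card Ω - S.arcCount c) * a := by
  simp only [← Finset.sum_mul, sum_sum_pair, ← Finset.mul_sum, Finset.sum_sub_distrib, arcCount]
  simp

lemma sum_pair_mul_tail_le (c : Equiv.Perm Ω) {g : Ω → ℝ} (hg : 0 ≤ g) :
    ∑ u, ∑ w, ∑ x, (S.pair u (c u) w (c x) : ℝ) * g w ≤ K * ∑ w, g w := by
  rw [Finset.sum_comm, Finset.mul_sum]
  refine Finset.sum_le_sum fun w _ => ?_
  have hsum : ∀ u, ∑ x, (S.pair u (c u) w (c x) : ℝ) = ∑ v, (S.pair u (c u) w v : ℝ) :=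
    fun u => Equiv.sum_comp c fun v => (S.pair u (c u) w v : ℝ)
  simp only [← Finset.sum_mul, hsum]
  exact mul_le_mul_of_nonneg_right (by exact_mod_cast S.sum_pair_tail_le c w) (hg w)

lemma sum_pair_mul_head_le (c : Equiv.Perm Ω) {g : Ω → ℝ} (hg : 0 ≤ g) :
    ∑ u, ∑ w, ∑ x, (S.pair u (c u) w (c x) : ℝ) * g x ≤ K * ∑ x, g x := by
  have hcomm : ∀ u, ∑ w, ∑ x, (S.pair u (c u) w (c x) : ℝ) * g x =
      ∑ x, ∑ w, (S.pair u (c u) w (c x) : ℝ) * g x := fun _ => Finset.sum_comm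
  simp only [hcomm]
  rw [Finset.sum_comm, Finset.mul_sum]
  refine Finset.sum_le_sum fun x _ => ?_
  simp only [← Finset.sum_mul]
  exact mul_le_mul_of_nonneg_right (by exact_mod_cast S.sum_pair_head_le c (c x)) (hg x)

variable [DecidableEq Ω]

/-- Splitting off the arcs at `u` and `x`: the pair they may form is counted in both loads. -/
lemma weight_add (c : Equiv.Perm Ω) {u x : Ω} (h : u ≠ x) :
    S.weight c + 2 * S.pair u (c u) x (c x) =
      S.weightOn c {u, x}ᶜ + S.load c u + S.load c x := by
  have hsplit : ∀ f : Ω → ℕ, ∑ z, f z = f u + f x + ∑ z ∈ {u, x}ᶜ, f z := fun f => by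
    rw [← Finset.sum_add_sum_compl {u, x} f, Finset.sum_pair h]
  have hcomm : ∀ y, ∑ z ∈ {u, x}ᶜ, S.pair z (c z) y (c y) =
      ∑ z ∈ {u, x}ᶜ, S.pair y (c y) z (c z) :=
    fun y => Finset.sum_congr rfl fun z _ => S.pair_comm _ _ _ _
  simp only [weight, weightOn, load, pairDegree, hsplit, Finset.sum_add_distrib, S.pair_same_tail]
  rw [hcomm u, hcomm x, S.pair_comm x (c x) u (c u)]
  ring

lemma weightOn_mul_swap (c : Equiv.Perm Ω) (u x : Ω) :
    S.weightOn (c * Equiv.swap u x) {u, x}ᶜ = S.weightOn c {u, x}ᶜ := by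
  have hfix : ∀ z ∈ ({u, x}ᶜ : Finset Ω), (c * Equiv.swap u x) z = c z := fun z hz => by
    simp only [Finset.mem_compl, Finset.mem_insert, Finset.mem_singleton, not_or] at hz
    rw [Equiv.Perm.mul_apply, Equiv.swap_apply_of_ne_of_ne hz.1 hz.2]
  simp +contextual only [weightOn, hfix]

lemma weight_mul_swap_le (c : Equiv.Perm Ω) (u x : Ω) :
    S.weight (c * Equiv.swap u x) ≤ S.weight c + (4 + 4 * d) := by
  rcases eq_or_ne u x with rfl | hne
  · simp [← Equiv.Perm.one_def]
  have hc := S.weight_add c hne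
  have hc' := S.weight_add (c * Equiv.swap u x) hne
  rw [S.weightOn_mul_swap] at hc'
  have hpair : 2 * S.pair u (c u) x (c x) ≤ S.load c u :=
    (Nat.mul_le_mul_left 2 (S.pair_le_pairDegree c u x)).trans (Nat.le_add_left _ _)
  have hu := S.load_le (c * Equiv.swap u x) u
  have hx := S.load_le (c * Equiv.swap u x) x
  lia

lemma weight_mul_swap_add_load (c : Equiv.Perm Ω) (u x : Ω) (h : S.load c x = 0)
    (h' : S.load (c * Equiv.swap u x) x = 0) :
    S.weight (c * Equiv.swap u x) + S.load c u =
      S.weight c + S.load (c * Equiv.swap u x) u := by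
  rcases eq_or_ne u x with rfl | hne
  · simp [← Equiv.Perm.one_def]
  have hpair : ∀ b : Equiv.Perm Ω, S.load b x = 0 → S.pair u (b u) x (b x) = 0 := fun b hb => by
    have := S.pair_le_pairDegree b x u
    rw [S.pair_comm]
    unfold load at hb
    lia
  have hc := S.weight_add c hne
  have hc' := S.weight_add (c * Equiv.swap u x) hne
  rw [S.weightOn_mul_swap, hpair _ h'] at hc'
  rw [hpair _ h] at hc
  lia

lemma expect_arc_mul_swap (G : Equiv.Perm Ω → Ω → ℝ) :
    𝔼 c : Equiv.Perm Ω, ∑ u, ∑ x, (S.arc u (c x) : ℝ) * G (c * Equiv.swap u x) x =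
      𝔼 c : Equiv.Perm Ω, S.arcCount c * ∑ x, G c x := by
  simpa [arcCount, Finset.sum_mul_sum] using
    expect_sum_sum_mul_swap fun (c : Equiv.Perm Ω) u x => (S.arc u (c u) : ℝ) * G c x

/-- Rewiring only the second arc of a pair keeps the first one in place, unless the arc at `u`
itself is rewired. -/
lemma expect_pair_mul_swap (G : Equiv.Perm Ω → Ω → Ω → Ω → ℝ) :
    𝔼 c : Equiv.Perm Ω, ∑ u, ∑ w, ∑ x,
        (S.pair u (c u) w (c x) : ℝ) * G (c * Equiv.swap w x) u w x =
      𝔼 c : Equiv.Perm Ω, ∑ u, ∑ w, ∑ x ∈ {u}ᶜ, (S.pair u (c u) w (c w) : ℝ) * G c u w x := by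
  rw [Finset.expect_sum_comm, Finset.expect_sum_comm]
  refine Finset.sum_congr rfl fun u _ => ?_
  have hcompl : ∀ f : Ω → ℝ, ∑ x ∈ {u}ᶜ, f x = ∑ x, if x = u then 0 else f x := fun f => by
    rw [← Finset.sum_add_sum_compl {u} fun x => if x = u then 0 else f x]
    simp +contextual only [Finset.sum_singleton, if_true, zero_add]
    exact Finset.sum_congr rfl fun x hx => (if_neg (by simpa using hx)).symm
  simp only [hcompl]
  rw [← expect_sum_sum_mul_swap]
  refine Finset.expect_congr rfl fun c _ => Finset.sum_congr rfl fun w _ =>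
    Finset.sum_congr rfl fun x _ => ?_
  split_ifs with hx
  · simp [hx, S.pair_same_head]
  rcases eq_or_ne u w with rfl | hw
  · simp [S.pair_same_tail]
  · simp [Equiv.swap_apply_of_ne_of_ne hw (Ne.symm hx)]

/-- Given the values of `c` on `s`, the value of `c` at `z ∉ s` is uniform on the remaining ones. -/
lemma card_compl_mul_expect (s : Finset Ω) (z : Ω) (F : Equiv.Perm Ω → Ω → ℝ)
    (hF : ∀ c, ∀ x ∉ s, ∀ v, F (c * Equiv.swap z x) v = F c v) :
    (sᶜ.card : ℝ) * 𝔼 c : Equiv.Perm Ω, F c (c z) = 𝔼 c : Equiv.Perm Ω, ∑ x ∈ sᶜ, F c (c x) := by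
  rw [← nsmul_eq_mul, ← Finset.sum_const, Finset.expect_sum_comm]
  refine Finset.sum_congr rfl fun x hx => ?_
  rw [← expect_mul_swap z x]
  simp [hF _ x (Finset.mem_compl.1 hx)]

lemma card_mul_expect_arcCount_mul (F : Equiv.Perm Ω → ℝ) :
    Fintype.card Ω * 𝔼 c, S.arcCount c * F c =
      𝔼 c : Equiv.Perm Ω, ∑ u, ∑ x, (S.arc u (c x) : ℝ) * F (c * Equiv.swap u x) := by
  rw [S.expect_arc_mul_swap fun c _ => F c, Finset.mul_expect]
  simp [mul_left_comm]

lemma card_sub_one_mul_expect_pairCount_mul (F : Equiv.Perm Ω → ℝ) :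
    (Fintype.card Ω - 1) * 𝔼 c, S.pairCount c * F c =
      𝔼 c : Equiv.Perm Ω, ∑ u, ∑ w, ∑ x,
        (S.pair u (c u) w (c x) : ℝ) * F (c * Equiv.swap w x) := by
  rcases isEmpty_or_nonempty Ω with _ | _
  · simp [pairCount]
  rw [S.expect_pair_mul_swap fun c _ _ _ => F c, Finset.mul_expect]
  simp [Finset.card_compl, Nat.cast_sub (Fintype.card_pos (α := Ω)), pairCount, pairDegree,
    Finset.sum_mul, Finset.mul_sum]

lemma expect_arcCount_mul_le [Nonempty Ω] {F G : Equiv.Perm Ω → ℝ}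
    (hFG : ∀ c u x, F (c * Equiv.swap u x) ≤ G c) :
    𝔼 c, S.arcCount c * F c ≤ r * 𝔼 c, G c := by
  refine le_of_mul_le_mul_left ?_ (Nat.cast_pos (α := ℝ).2 (Fintype.card_pos (α := Ω)))
  calc Fintype.card Ω * 𝔼 c, S.arcCount c * F c
      = 𝔼 c : Equiv.Perm Ω, ∑ u, ∑ x, (S.arc u (c x) : ℝ) * F (c * Equiv.swap u x) :=
        S.card_mul_expect_arcCount_mul F
    _ ≤ 𝔼 c : Equiv.Perm Ω, ∑ u, ∑ x, (S.arc u (c x) : ℝ) * G c := by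
        gcongr; exact hFG _ _ _
    _ = 𝔼 c, r * (Fintype.card Ω * G c) := by
        simp [S.sum_arc_mul_left _ fun _ => G _]
    _ = Fintype.card Ω * (r * 𝔼 c, G c) := by
        simp only [← Finset.mul_expect]; ring

lemma expect_pairCount_mul_le (hN : 2 ≤ Fintype.card Ω) {F G : Equiv.Perm Ω → ℝ}
    (hG : 0 ≤ G) (hFG : ∀ c u x, F (c * Equiv.swap u x) ≤ G c) :
    𝔼 c, S.pairCount c * F c ≤ 2 * d * 𝔼 c, G c := by
  have hN' : (2 : ℝ) ≤ Fintype.card Ω := by exact_mod_cast hN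
  refine le_of_mul_le_mul_left ?_ (by linarith : (0 : ℝ) < Fintype.card Ω - 1)
  calc (Fintype.card Ω - 1) * 𝔼 c, S.pairCount c * F c
      = 𝔼 c : Equiv.Perm Ω, ∑ u, ∑ w, ∑ x,
          (S.pair u (c u) w (c x) : ℝ) * F (c * Equiv.swap w x) :=
        S.card_sub_one_mul_expect_pairCount_mul F
    _ ≤ 𝔼 c : Equiv.Perm Ω, ∑ u, ∑ w, ∑ x, (S.pair u (c u) w (c x) : ℝ) * G c := by
        gcongr; exact hFG _ _ _
    _ ≤ 𝔼 c, (Fintype.card Ω - 1) * (2 * d) * G c := by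
        simp only [sum_pair_mul_const]
        refine Finset.expect_le_expect fun c _ => mul_le_mul_of_nonneg_right ?_ (hG c)
        have : (0 : ℝ) ≤ S.arcCount c := Nat.cast_nonneg _
        have : (0 : ℝ) ≤ d := Nat.cast_nonneg _
        nlinarith
    _ = (Fintype.card Ω - 1) * (2 * d * 𝔼 c, G c) := by
        rw [← Finset.mul_expect]; ring

lemma expect_weight_mul_le (hN : 2 ≤ Fintype.card Ω) {F G : Equiv.Perm Ω → ℝ}
    (hG : 0 ≤ G) (hFG : ∀ c u x, F (c * Equiv.swap u x) ≤ G c) :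
    𝔼 c, S.weight c * F c ≤ (2 * r + 2 * d) * 𝔼 c, G c := by
  have : Nonempty Ω := Fintype.card_pos_iff.1 (by lia)
  have harc := S.expect_arcCount_mul_le hFG
  have hpair := S.expect_pairCount_mul_le hN hG hFG
  simp only [weight_eq, Nat.cast_add, Nat.cast_mul, Nat.cast_ofNat, add_mul, mul_assoc,
    Finset.expect_add_distrib, ← Finset.mul_expect] at hpair ⊢
  linarith

lemma expect_weight_le (hN : 2 ≤ Fintype.card Ω) :
    𝔼 c, (S.weight c : ℝ) ≤ 2 * r + 2 * d := by
  simpa using S.expect_weight_mul_le hN (F := 1) (G := 1) zero_le_one (by simp)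

lemma expect_weight_sq_le (hN : 2 ≤ Fintype.card Ω) :
    𝔼 c, (S.weight c : ℝ) ^ 2 ≤ (2 * r + 2 * d) * (2 * r + 6 * d + 4) := by
  calc 𝔼 c, (S.weight c : ℝ) ^ 2 = 𝔼 c, (S.weight c : ℝ) * S.weight c := by simp only [sq]
    _ ≤ (2 * r + 2 * d) * 𝔼 c, ((S.weight c : ℝ) + (4 + 4 * d)) :=
        S.expect_weight_mul_le hN (fun c => by positivity)
          fun c u x => by exact_mod_cast S.weight_mul_swap_le c u x
    _ ≤ (2 * r + 2 * d) * (2 * r + 6 * d + 4) := by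
        rw [Finset.expect_add_distrib, Fintype.expect_const]
        refine mul_le_mul_of_nonneg_left ?_ (by positivity)
        linarith [S.expect_weight_le hN]

/-- The interference of the arcs at `u` and `x` with the rest of `c` when their heads are switched;
the new arc at `u` is left out. -/
def switchLoad (c : Equiv.Perm Ω) (u x : Ω) : ℕ :=
  S.load c u + S.load c x + S.load (c * Equiv.swap u x) x

/-- A switch whose new arc at `u` brings in a single forbidden structure, counted twice, should
shift the weight by `2`; it does so unless there is interference. -/
lemma abs_weight_mul_swap_sub_le {f : ℕ → ℝ} (hf₀ : ∀ k, 0 ≤ f k) (hf₁ : ∀ k, f k ≤ 1)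
    {c : Equiv.Perm Ω} {u x : Ω} {e : ℕ} (h : S.load (c * Equiv.swap u x) u = 2 + e) :
    |f (S.weight (c * Equiv.swap u x)) - f (S.weight c + 2)| ≤ (S.switchLoad c u x : ℝ) + e := by
  rcases Nat.eq_zero_or_pos (S.switchLoad c u x + e) with h0 | hpos
  · have hweight : S.weight (c * Equiv.swap u x) = S.weight c + 2 := by
      unfold switchLoad at h0
      have := S.weight_mul_swap_add_load c u x (by lia) (by lia)
      lia
    rw [hweight, sub_self, abs_zero]
    positivity
  · calc |f (S.weight (c * Equiv.swap u x)) - f (S.weight c + 2)| ≤ 1 :=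
          abs_sub_le_iff.2 ⟨by linarith [hf₀ (S.weight c + 2), hf₁ (S.weight (c * Equiv.swap u x))],
            by linarith [hf₁ (S.weight c + 2), hf₀ (S.weight (c * Equiv.swap u x))]⟩
      _ ≤ (S.switchLoad c u x : ℝ) + e := by exact_mod_cast hpos

lemma load_mul_swap_of_arc {c : Equiv.Perm Ω} {u x : Ω} (h : S.arc u (c x) ≠ 0) :
    S.load (c * Equiv.swap u x) u = 2 := by
  have harc := S.arc_le_one u (c x)
  simp only [load, pairDegree, Equiv.Perm.mul_apply, Equiv.swap_apply_left,
    S.pair_eq_zero_of_arc _ _ _ _ h, Finset.sum_const_zero]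
  lia

/-- The number of arcs of `c`, other than the one with tail `u`, that form a forbidden pair with the
arc with tail `w`. -/
def pairDegreeExcept (c : Equiv.Perm Ω) (u w : Ω) : ℕ := ∑ z ∈ {u}ᶜ, S.pair w (c w) z (c z)

lemma load_mul_swap_of_pair {c : Equiv.Perm Ω} {u w x : Ω} (h : S.pair u (c u) w (c x) ≠ 0) :
    S.load (c * Equiv.swap w x) w =
      2 + 2 * S.pairDegreeExcept (c * Equiv.swap w x) u w := by
  have huw : u ≠ w := by rintro rfl; exact h (S.pair_same_tail _ _ _)
  have hux : u ≠ x := by rintro rfl; exact h (S.pair_same_head _ _ _)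
  rw [S.pair_comm] at h
  have harc : S.arc w (c x) = 0 := by_contra fun harc => h (S.pair_eq_zero_of_arc _ _ _ _ harc)
  have hpair : S.pair w (c x) u (c u) = 1 := le_antisymm (S.pair_le_one _ _ _ _) (by lia)
  rw [load, pairDegree, ← Finset.sum_add_sum_compl {u}, Finset.sum_singleton, ← pairDegreeExcept]
  simp only [Equiv.Perm.mul_apply, Equiv.swap_apply_left, Equiv.swap_apply_of_ne_of_ne huw hux,
    harc, hpair]
  ring

lemma expect_arc_mul_switchLoad_le :
    𝔼 c : Equiv.Perm Ω, ∑ u, ∑ x, (S.arc u (c x) : ℝ) * S.switchLoad c u x ≤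
      4 * r * 𝔼 c, (S.weight c : ℝ) + 2 * 𝔼 c, (S.weight c : ℝ) ^ 2 := by
  have hload : ∀ c, ∑ u, (S.load c u : ℝ) ≤ 2 * S.weight c := fun c => by
    exact_mod_cast S.sum_load_le c
  simp only [switchLoad, Nat.cast_add, mul_add, Finset.sum_add_distrib,
    Finset.expect_add_distrib, S.sum_arc_mul_left _ fun u => (S.load _ u : ℝ),
    S.sum_arc_mul_right _ fun x => (S.load _ x : ℝ),
    S.expect_arc_mul_swap fun c x => (S.load c x : ℝ), Finset.mul_expect]
  simp only [← Finset.expect_add_distrib]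
  refine Finset.expect_le_expect fun c _ => ?_
  have hr := mul_le_mul_of_nonneg_left (hload c) (Nat.cast_nonneg (α := ℝ) r)
  have harc : S.arcCount c * ∑ u, (S.load c u : ℝ) ≤ S.weight c * (2 * S.weight c) :=
    mul_le_mul (by exact_mod_cast S.arcCount_le_weight c) (hload c)
      (Finset.sum_nonneg fun _ _ => Nat.cast_nonneg _) (Nat.cast_nonneg _)
  linarith

lemma abs_expect_arcCount_mul_sub_le {f : ℕ → ℝ} (hf₀ : ∀ k, 0 ≤ f k) (hf₁ : ∀ k, f k ≤ 1) :
    |Fintype.card Ω * 𝔼 c, (S.arcCount c * f (S.weight c) - r * f (S.weight c + 2))| ≤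
      4 * r * 𝔼 c, (S.weight c : ℝ) + 2 * 𝔼 c, (S.weight c : ℝ) ^ 2 := by
  have hpoint : ∀ (c : Equiv.Perm Ω) (u x : Ω), |(S.arc u (c x) : ℝ) *
      (f (S.weight (c * Equiv.swap u x)) - f (S.weight c + 2))| ≤
        S.arc u (c x) * S.switchLoad c u x := fun c u x => by
    rw [abs_mul, Nat.abs_cast]
    by_cases h : S.arc u (c x) = 0
    · simp [h]
    · refine mul_le_mul_of_nonneg_left ?_ (Nat.cast_nonneg _)
      simpa using S.abs_weight_mul_swap_sub_le hf₀ hf₁ (e := 0) (S.load_mul_swap_of_arc h)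
  calc |Fintype.card Ω * 𝔼 c, (S.arcCount c * f (S.weight c) - r * f (S.weight c + 2))|
      = |𝔼 c : Equiv.Perm Ω, ∑ u, ∑ x, (S.arc u (c x) : ℝ) *
          (f (S.weight (c * Equiv.swap u x)) - f (S.weight c + 2))| := by
        rw [Finset.expect_sub_distrib, mul_sub,
          S.card_mul_expect_arcCount_mul fun c => f (S.weight c)]
        simp only [mul_sub, Finset.sum_sub_distrib, Finset.expect_sub_distrib,
          S.sum_arc_mul_left _ fun _ => f (S.weight _ + 2)]
        simp [← Finset.mul_expect, mul_left_comm]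
    _ ≤ 𝔼 c : Equiv.Perm Ω, ∑ u, ∑ x, (S.arc u (c x) : ℝ) * S.switchLoad c u x :=
        (Finset.abs_expect_le _ _).trans <| Finset.expect_le_expect fun c _ =>
          abs_sum_le_sum fun u _ => abs_sum_le_sum fun x _ => hpoint c u x
    _ ≤ _ := S.expect_arc_mul_switchLoad_le

lemma card_sub_two_mul_expect_pair_mul_pair_le (u w : Ω) {z : Ω} (hzu : z ≠ u) :
    ((Fintype.card Ω : ℝ) - 2) * 𝔼 c : Equiv.Perm Ω,
        (S.pair u (c u) w (c w) * S.pair w (c w) z (c z) : ℝ) ≤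
      𝔼 c : Equiv.Perm Ω, S.pair u (c u) w (c w) * ∑ v, (S.pair w (c w) z v : ℝ) := by
  rcases eq_or_ne w u with rfl | hwu
  · simp [S.pair_same_tail]
  rcases eq_or_ne w z with rfl | hwz
  · simp [S.pair_same_tail]
  have hcard : (({w, u} : Finset Ω)ᶜ.card : ℝ) = Fintype.card Ω - 2 := by
    rw [Finset.card_compl, Finset.card_pair hwu,
      Nat.cast_sub ((Finset.card_pair hwu).symm.le.trans (Finset.card_le_univ _)), Nat.cast_two]
  rw [← hcard, card_compl_mul_expect {w, u} z
    fun c v => (S.pair u (c u) w (c w) * S.pair w (c w) z v : ℝ)]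
  · refine Finset.expect_le_expect fun c _ => ?_
    rw [← Equiv.sum_comp c, Finset.mul_sum]
    exact Finset.sum_le_univ_sum_of_nonneg fun x => by positivity
  · intro c x hx v
    simp only [Finset.mem_insert, Finset.mem_singleton, not_or] at hx
    simp [Equiv.swap_apply_of_ne_of_ne hwz (Ne.symm hx.1),
      Equiv.swap_apply_of_ne_of_ne hzu.symm (Ne.symm hx.2)]

/-- The number of arcs of `c` together with an ordered choice of two further arcs of `c` that both
form a forbidden pair with it. -/
def cherryCount (c : Equiv.Perm Ω) : ℕ :=
  ∑ u, ∑ w, S.pair u (c u) w (c w) * S.pairDegreeExcept c u w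

lemma card_sub_two_mul_expect_cherryCount_le :
    ((Fintype.card Ω : ℝ) - 2) * 𝔼 c, (S.cherryCount c : ℝ) ≤ d * 𝔼 c, (S.pairCount c : ℝ) := by
  calc ((Fintype.card Ω : ℝ) - 2) * 𝔼 c, (S.cherryCount c : ℝ)
      = ∑ u, ∑ w, ∑ z ∈ {u}ᶜ, ((Fintype.card Ω : ℝ) - 2) * 𝔼 c : Equiv.Perm Ω,
          (S.pair u (c u) w (c w) * S.pair w (c w) z (c z) : ℝ) := by
        simp only [cherryCount, pairDegreeExcept, Nat.cast_sum, Nat.cast_mul, Finset.mul_sum,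
          Finset.expect_sum_comm]
    _ ≤ ∑ u, ∑ w, ∑ z ∈ {u}ᶜ, 𝔼 c : Equiv.Perm Ω,
          S.pair u (c u) w (c w) * ∑ v, (S.pair w (c w) z v : ℝ) :=
        Finset.sum_le_sum fun u _ => Finset.sum_le_sum fun w _ => Finset.sum_le_sum fun z hz =>
          S.card_sub_two_mul_expect_pair_mul_pair_le u w (by simpa using hz)
    _ = 𝔼 c : Equiv.Perm Ω, ∑ u, ∑ w, S.pair u (c u) w (c w) *
          ∑ z ∈ {u}ᶜ, ∑ v, (S.pair w (c w) z v : ℝ) := by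
        simp only [Finset.mul_sum, Finset.expect_sum_comm]
    _ ≤ 𝔼 c : Equiv.Perm Ω, ∑ u, ∑ w, S.pair u (c u) w (c w) * (d : ℝ) := by
        gcongr with c _ u _ w _
        exact_mod_cast (Finset.sum_le_univ_sum_of_nonneg fun _ => Nat.zero_le _).trans
          (S.sum_pair_le w (c w))
    _ = d * 𝔼 c, (S.pairCount c : ℝ) := by
        simp [pairCount, pairDegree, Finset.mul_expect, Finset.mul_sum, mul_comm]

lemma expect_pair_mul_switchLoad_le :
    𝔼 c : Equiv.Perm Ω, ∑ u, ∑ w, ∑ x, (S.pair u (c u) w (c x) : ℝ) * S.switchLoad c w x ≤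
      4 * K * 𝔼 c, (S.weight c : ℝ) + 2 * 𝔼 c, (S.weight c : ℝ) ^ 2 := by
  have hload : ∀ c, ∑ u, (S.load c u : ℝ) ≤ 2 * S.weight c := fun c => by
    exact_mod_cast S.sum_load_le c
  simp only [switchLoad, Nat.cast_add, mul_add, Finset.sum_add_distrib,
    Finset.expect_add_distrib,
    S.expect_pair_mul_swap fun c _ _ x => (S.load c x : ℝ)]
  simp only [Finset.mul_expect, ← Finset.expect_add_distrib]
  refine Finset.expect_le_expect fun c _ => ?_
  have hK := mul_le_mul_of_nonneg_left (hload c) (Nat.cast_nonneg (α := ℝ) K)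
  have htail := S.sum_pair_mul_tail_le c (g := fun w => (S.load c w : ℝ)) fun _ => by positivity
  have hhead := S.sum_pair_mul_head_le c (g := fun x => (S.load c x : ℝ)) fun _ => by positivity
  have hpair : ∑ u, ∑ w, ∑ x ∈ {u}ᶜ, (S.pair u (c u) w (c w) : ℝ) * S.load c x ≤
      S.weight c * (2 * S.weight c) := by
    calc _ ≤ ∑ u, ∑ w, (S.pair u (c u) w (c w) : ℝ) * (2 * S.weight c) :=
          Finset.sum_le_sum fun u _ => Finset.sum_le_sum fun w _ => by
            rw [← Finset.mul_sum]
            exact mul_le_mul_of_nonneg_left ((Finset.sum_le_univ_sum_of_nonneg fun _ =>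
              Nat.cast_nonneg _).trans (hload c)) (Nat.cast_nonneg _)
      _ = S.pairCount c * (2 * S.weight c) := by
          simp [pairCount, pairDegree, Finset.sum_mul]
      _ ≤ _ := mul_le_mul_of_nonneg_right (by exact_mod_cast S.pairCount_le_weight c)
          (by positivity)
  linarith

lemma expect_pair_mul_pairDegreeExcept_le (hN : 3 ≤ Fintype.card Ω) :
    𝔼 c : Equiv.Perm Ω, ∑ u, ∑ w, ∑ x, (S.pair u (c u) w (c x) : ℝ) *
        S.pairDegreeExcept (c * Equiv.swap w x) u w ≤ 2 * d * 𝔼 c, (S.weight c : ℝ) := by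
  have hN' : (3 : ℝ) ≤ Fintype.card Ω := by exact_mod_cast hN
  have hcherry : (0 : ℝ) ≤ 𝔼 c, (S.cherryCount c : ℝ) :=
    Finset.expect_nonneg fun _ _ => Nat.cast_nonneg _
  have hpair : 𝔼 c, (S.pairCount c : ℝ) ≤ 𝔼 c, (S.weight c : ℝ) :=
    Finset.expect_le_expect fun c _ => by exact_mod_cast S.pairCount_le_weight c
  rw [S.expect_pair_mul_swap fun c u w _ => (S.pairDegreeExcept c u w : ℝ)]
  calc _ = (Fintype.card Ω - 1) * 𝔼 c, (S.cherryCount c : ℝ) := by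
        rw [Finset.mul_expect]
        refine Finset.expect_congr rfl fun c _ => ?_
        simp [cherryCount, Finset.card_compl, Nat.cast_sub (by lia : 1 ≤ Fintype.card Ω),
          Finset.mul_sum]
    _ ≤ 2 * ((Fintype.card Ω - 2) * 𝔼 c, (S.cherryCount c : ℝ)) := by nlinarith
    _ ≤ 2 * (d * 𝔼 c, (S.weight c : ℝ)) := by
        refine mul_le_mul_of_nonneg_left ?_ zero_le_two
        exact S.card_sub_two_mul_expect_cherryCount_le.trans (by gcongr)
    _ = _ := by ring

lemma abs_expect_mul_one_sub_arcCount_le {f : ℕ → ℝ} (hf₀ : ∀ k, 0 ≤ f k) (hf₁ : ∀ k, f k ≤ 1) :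
    |𝔼 c, d * (1 - S.arcCount c) * f (S.weight c + 2)| ≤ d * 𝔼 c, (S.weight c : ℝ) + d := by
  have hpoint : ∀ c, |d * (1 - S.arcCount c) * f (S.weight c + 2)| ≤
      (d * (S.weight c + 1) : ℝ) := fun c => by
    have hle : (S.arcCount c : ℝ) ≤ S.weight c := by exact_mod_cast S.arcCount_le_weight c
    have : (0 : ℝ) ≤ S.arcCount c := Nat.cast_nonneg _
    rw [abs_mul, abs_mul, Nat.abs_cast, abs_of_nonneg (hf₀ _)]
    exact (mul_le_of_le_one_right (by positivity) (hf₁ _)).trans <|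
      mul_le_mul_of_nonneg_left (abs_le.2 ⟨by linarith, by linarith⟩) (Nat.cast_nonneg _)
  calc |𝔼 c, d * (1 - S.arcCount c) * f (S.weight c + 2)|
      ≤ 𝔼 c, (d * (S.weight c + 1) : ℝ) :=
        (Finset.abs_expect_le _ _).trans <| Finset.expect_le_expect fun c _ => hpoint c
    _ = d * 𝔼 c, (S.weight c : ℝ) + d := by
        rw [← Finset.mul_expect, Finset.expect_add_distrib, Fintype.expect_const, mul_add, mul_one]

lemma abs_expect_pairCount_mul_sub_le (hN : 3 ≤ Fintype.card Ω) {f : ℕ → ℝ} (hf₀ : ∀ k, 0 ≤ f k)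
    (hf₁ : ∀ k, f k ≤ 1) :
    |(Fintype.card Ω - 1) * 𝔼 c, (S.pairCount c * f (S.weight c) - d * f (S.weight c + 2))| ≤
      (4 * K + 5 * d) * 𝔼 c, (S.weight c : ℝ) + 2 * 𝔼 c, (S.weight c : ℝ) ^ 2 + d := by
  have hpoint : ∀ (c : Equiv.Perm Ω) (u w x : Ω), |(S.pair u (c u) w (c x) : ℝ) *
      (f (S.weight (c * Equiv.swap w x)) - f (S.weight c + 2))| ≤
        S.pair u (c u) w (c x) * S.switchLoad c w x +
          2 * (S.pair u (c u) w (c x) * S.pairDegreeExcept (c * Equiv.swap w x) u w) := by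
    intro c u w x
    rw [abs_mul, Nat.abs_cast, mul_left_comm, ← mul_add]
    by_cases h : S.pair u (c u) w (c x) = 0
    · simp [h]
    · refine mul_le_mul_of_nonneg_left ?_ (Nat.cast_nonneg _)
      exact_mod_cast S.abs_weight_mul_swap_sub_le hf₀ hf₁ (S.load_mul_swap_of_pair h)
  have hswitch : |𝔼 c : Equiv.Perm Ω, ∑ u, ∑ w, ∑ x, (S.pair u (c u) w (c x) : ℝ) *
      (f (S.weight (c * Equiv.swap w x)) - f (S.weight c + 2))| ≤
        (4 * K + 4 * d) * 𝔼 c, (S.weight c : ℝ) + 2 * 𝔼 c, (S.weight c : ℝ) ^ 2 := by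
    refine ((Finset.abs_expect_le _ _).trans <| Finset.expect_le_expect fun c _ =>
      abs_sum_le_sum fun u _ => abs_sum_le_sum fun w _ => abs_sum_le_sum fun x _ =>
        hpoint c u w x).trans ?_
    simp only [Finset.sum_add_distrib, Finset.expect_add_distrib, ← Finset.mul_sum,
      ← Finset.mul_expect]
    linarith [S.expect_pair_mul_switchLoad_le, S.expect_pair_mul_pairDegreeExcept_le hN]
  calc |(Fintype.card Ω - 1) * 𝔼 c, (S.pairCount c * f (S.weight c) - d * f (S.weight c + 2))|
      = |(𝔼 c : Equiv.Perm Ω, ∑ u, ∑ w, ∑ x, (S.pair u (c u) w (c x) : ℝ) *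
          (f (S.weight (c * Equiv.swap w x)) - f (S.weight c + 2))) +
          𝔼 c, d * (1 - S.arcCount c) * f (S.weight c + 2)| := by
        rw [Finset.expect_sub_distrib, mul_sub,
          S.card_sub_one_mul_expect_pairCount_mul fun c => f (S.weight c)]
        simp only [mul_sub, Finset.sum_sub_distrib, Finset.expect_sub_distrib,
          sum_pair_mul_const, Finset.mul_expect, sub_mul]
        ring_nf
    _ ≤ _ := by
        refine (abs_add_le _ _).trans ?_
        linarith [S.abs_expect_mul_one_sub_arcCount_le hf₀ hf₁]

/-- An approximate size-bias identity for the weight, uniform in the test function. -/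
lemma abs_expect_weight_mul_sub_le (hN : 3 ≤ Fintype.card Ω) {f : ℕ → ℝ} (hf₀ : ∀ k, 0 ≤ f k)
    (hf₁ : ∀ k, f k ≤ 1) :
    |𝔼 c, (S.weight c * f (S.weight c) - (2 * r + d) * f (S.weight c + 2))| ≤
      ((8 * r + 8 * K + 10 * d) * 𝔼 c, (S.weight c : ℝ) + 8 * 𝔼 c, (S.weight c : ℝ) ^ 2 + 2 * d) /
        Fintype.card Ω := by
  have hN' : (3 : ℝ) ≤ Fintype.card Ω := by exact_mod_cast hN
  have harc := S.abs_expect_arcCount_mul_sub_le hf₀ hf₁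
  have hpair := S.abs_expect_pairCount_mul_sub_le hN hf₀ hf₁
  set X := 𝔼 c, (S.arcCount c * f (S.weight c) - r * f (S.weight c + 2))
  set Y := 𝔼 c, (S.pairCount c * f (S.weight c) - d * f (S.weight c + 2))
  have hsum : 𝔼 c, (S.weight c * f (S.weight c) - (2 * r + d) * f (S.weight c + 2)) =
      2 * X + Y := by
    simp only [X, Y, Finset.mul_expect, ← Finset.expect_add_distrib, weight_eq]
    exact Finset.expect_congr rfl fun c _ => by push_cast; ring
  rw [abs_mul, abs_of_pos (by linarith)] at harc hpair
  rw [hsum, le_div_iff₀ (by linarith)]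
  calc |2 * X + Y| * Fintype.card Ω ≤ (2 * |X| + |Y|) * Fintype.card Ω := by
        refine mul_le_mul_of_nonneg_right ((abs_add_le _ _).trans ?_) (Nat.cast_nonneg _)
        rw [abs_mul, abs_two]
    _ ≤ 2 * (Fintype.card Ω * |X|) + 2 * ((Fintype.card Ω - 1) * |Y|) := by
        nlinarith [abs_nonneg Y]
    _ ≤ _ := by linarith

/-- The probability that a uniformly random permutation contains no forbidden structure. -/
noncomputable def avoidProb : ℝ := 𝔼 c, if S.weight c = 0 then (1 : ℝ) else 0

lemma abs_avoidProb_sub_exp_le (hN : 3 ≤ Fintype.card Ω) :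
    |S.avoidProb - Real.exp (-((2 * r + d) / 2))| ≤
      ((8 * r + 8 * K + 10 * d) * (2 * r + 2 * d) +
        8 * ((2 * r + 2 * d) * (2 * r + 6 * d + 4)) + 2 * d) / Fintype.card Ω := by
  calc |S.avoidProb - Real.exp (-((2 * r + d) / 2))|
      = |𝔼 c, (S.weight c * steinSolution (2 * r + d) (S.weight c) -
          (2 * r + d) * steinSolution (2 * r + d) (S.weight c + 2))| := by
        simp only [stein_equation, Finset.expect_sub_distrib, Fintype.expect_const]
        exact abs_sub_comm _ _
    _ ≤ ((8 * r + 8 * K + 10 * d) * 𝔼 c, (S.weight c : ℝ) + 8 * 𝔼 c, (S.weight c : ℝ) ^ 2 +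
          2 * d) / Fintype.card Ω :=
        S.abs_expect_weight_mul_sub_le hN (steinSolution_nonneg _)
          (steinSolution_le_one (by positivity))
    _ ≤ _ := by
        gcongr
        · exact S.expect_weight_le (by lia)
        · exact S.expect_weight_sq_le (by lia)

theorem tendsto_avoidProb {ι : Type*} {l : Filter ι} {Ω : ι → Type*} [∀ i, Fintype (Ω i)]
    [∀ i, DecidableEq (Ω i)] (S : ∀ i, ForbiddenPattern (Ω i) r d K)
    (hcard : Tendsto (fun i => Fintype.card (Ω i)) l atTop) :
    Tendsto (fun i => (S i).avoidProb) l (𝓝 (Real.exp (-((2 * r + d) / 2)))) := by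
  have hrate : ∀ C : ℝ, Tendsto (fun i => C / (Fintype.card (Ω i) : ℝ)) l (𝓝 0) := fun C =>
    tendsto_const_nhds.div_atTop (tendsto_natCast_atTop_atTop.comp hcard)
  exact tendsto_iff_norm_sub_tendsto_zero.2 <| squeeze_zero' (.of_forall fun _ => norm_nonneg _)
    ((hcard.eventually_ge_atTop 3).mono fun i hi => (S i).abs_avoidProb_sub_exp_le hi) (hrate _)

end ForbiddenPattern

namespace DirectedConfiguration

variable {n r : ℕ}

lemma sum_fst_eq (i : Fin n) : ∑ u : Fin n × Fin r, (if u.1 = i then 1 else 0) = r := by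
  rw [Fintype.sum_prod_type_right]
  simp

lemma sum_eq_fst (i : Fin n) : ∑ u : Fin n × Fin r, (if i = u.1 then 1 else 0) = r := by
  rw [Fintype.sum_prod_type_right]
  simp

lemma sum_apply_fst_eq (c : DirectedConfiguration n r) (i : Fin n) :
    ∑ u, (if (c u).1 = i then 1 else 0) = r :=
  (Equiv.sum_comp c fun u => if u.1 = i then 1 else 0).trans (sum_fst_eq i)

lemma sum_ne_and_eq_fst (u : Fin n × Fin r) :
    ∑ u' : Fin n × Fin r, (if u ≠ u' ∧ u.1 = u'.1 then 1 else 0) = r - 1 := by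
  have hcard : ∑ u' : Fin n × Fin r, (if u ≠ u' ∧ u.1 = u'.1 then 1 else 0) =
      ((Finset.univ.filter fun u' : Fin n × Fin r => u.1 = u'.1).erase u).card := by
    rw [Finset.sum_boole, Nat.cast_id]
    congr 1
    ext u'
    simp [eq_comm]
  rw [hcard, Finset.card_erase_of_mem (by simp), ← Nat.cast_id (Finset.card _),
    ← Finset.sum_boole, sum_eq_fst]

/-- The pairs of points `(u, v)` and `(u', v')` have no point in common and give two arcs that are
no loops and are parallel or form a digon. -/
abbrev Clash (u v u' v' : Fin n × Fin r) : Prop :=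
  u.1 ≠ v.1 ∧ u ≠ u' ∧ v ≠ v' ∧ ((u.1 = u'.1 ∧ v.1 = v'.1) ∨ (u.1 = v'.1 ∧ v.1 = u'.1))

lemma clash_comm {u v u' v' : Fin n × Fin r} : Clash u v u' v' ↔ Clash u' v' u v := by
  grind

lemma ite_clash_le (u v u' v' : Fin n × Fin r) :
    (if Clash u v u' v' then 1 else 0) ≤
      (if u.1 = u'.1 then 1 else 0) * (if v.1 = v'.1 then 1 else 0) +
        (if u.1 = v'.1 then 1 else 0) * (if v.1 = u'.1 then 1 else 0) := by
  grind

lemma ite_clash_eq {u v : Fin n × Fin r} (h : u.1 ≠ v.1) (u' v' : Fin n × Fin r) :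
    (if Clash u v u' v' then 1 else 0) =
      (if u ≠ u' ∧ u.1 = u'.1 then 1 else 0) * (if v ≠ v' ∧ v.1 = v'.1 then 1 else 0) +
        (if v.1 = u'.1 then 1 else 0) * (if u.1 = v'.1 then 1 else 0) := by
  grind

/-- The forbidden arcs are the loops, and the forbidden pairs are the pairs of parallel arcs and
the digons. An arc that is no loop is in `(r - 1) ^ 2` pairs of the former kind and in `r ^ 2` of
the latter. -/
def orientedPattern (n r : ℕ) :
    ForbiddenPattern (Fin n × Fin r) r ((r - 1) ^ 2 + r ^ 2) (2 * r ^ 2) where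
  arc u v := if u.1 = v.1 then 1 else 0
  pair u v u' v' := if Clash u v u' v' then 1 else 0
  arc_le_one u v := by split_ifs <;> simp
  pair_le_one u v u' v' := by split_ifs <;> simp
  sum_arc_right u := sum_eq_fst u.1
  sum_arc_left v := sum_fst_eq v.1
  pair_comm u v u' v' := by simp only [clash_comm]
  pair_eq_zero_of_arc u v u' v' h := if_neg fun hclash => h (if_neg hclash.1)
  pair_same_tail u v v' := by simp
  pair_same_head u v u' := by simp
  sum_pair u v h := by
    have hne : u.1 ≠ v.1 := by simpa using h
    simp only [ite_clash_eq hne, Finset.sum_add_distrib, ← Finset.sum_mul_sum, sum_ne_and_eq_fst,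
      sum_eq_fst]
    ring
  sum_pair_tail_le c w := by
    refine (Finset.sum_le_sum fun u _ => Finset.sum_le_sum fun v _ =>
      ite_clash_le _ _ _ _).trans_eq ?_
    simp only [Finset.sum_add_distrib, ← Finset.mul_sum, ← Finset.sum_mul, sum_fst_eq, sum_eq_fst,
      sum_apply_fst_eq]
    ring
  sum_pair_head_le c v := by
    refine (Finset.sum_le_sum fun u _ => Finset.sum_le_sum fun w _ =>
      ite_clash_le _ _ _ _).trans_eq ?_
    simp only [Finset.sum_add_distrib, ← Finset.mul_sum, ← Finset.sum_mul, sum_fst_eq, sum_eq_fst,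
      sum_apply_fst_eq]
    ring

lemma loopless_iff (c : DirectedConfiguration n r) :
    c.toMultidigraph.Loopless ↔ ∀ u, u.1 ≠ (c u).1 := by
  simp only [Multidigraph.Loopless, toMultidigraph, Finset.card_eq_zero,
    Finset.filter_eq_empty_iff, Finset.mem_univ, true_implies]
  exact ⟨fun h u hu => h u.1 ⟨rfl, hu.symm⟩, fun h i u hu => h u (hu.1.trans hu.2.symm)⟩

lemma noParallelArcs_iff (c : DirectedConfiguration n r) :
    c.toMultidigraph.NoParallelArcs ↔ ∀ u w, u.1 = w.1 → (c u).1 = (c w).1 → u = w := by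
  simp only [Multidigraph.NoParallelArcs, toMultidigraph, Finset.card_le_one,
    Finset.mem_filter, Finset.mem_univ, true_and]
  exact ⟨fun h u w h₁ h₂ => h u.1 (c u).1 u ⟨rfl, rfl⟩ w ⟨h₁.symm, h₂.symm⟩,
    fun h i j u hu w hw => h u w (hu.1.trans hw.1.symm) (hu.2.trans hw.2.symm)⟩

lemma digonFree_iff (c : DirectedConfiguration n r) :
    c.toMultidigraph.DigonFree ↔ ∀ u w, u.1 ≠ (c u).1 → u.1 = (c w).1 → (c u).1 ≠ w.1 := by
  simp only [Multidigraph.DigonFree, toMultidigraph, Finset.card_pos, Finset.Nonempty,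
    Finset.mem_filter, Finset.mem_univ, true_and]
  constructor
  · exact fun h u w hu h₁ h₂ => h u.1 (c u).1 hu ⟨⟨u, rfl, rfl⟩, ⟨w, h₂.symm, h₁.symm⟩⟩
  · rintro h i j hij ⟨⟨u, rfl, rfl⟩, ⟨w, hw, hcw⟩⟩
    exact h u w hij hcw.symm hw.symm

lemma weight_orientedPattern_eq_zero_iff (c : DirectedConfiguration n r) :
    (orientedPattern n r).weight c = 0 ↔
      (∀ u, u.1 ≠ (c u).1) ∧ ∀ u w, ¬ Clash u (c u) w (c w) := by
  simp only [ForbiddenPattern.weight_eq, ForbiddenPattern.arcCount, ForbiddenPattern.pairCount,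
    ForbiddenPattern.pairDegree, orientedPattern, Nat.add_eq_zero_iff, mul_eq_zero,
    Finset.sum_eq_zero_iff, ite_eq_right_iff, one_ne_zero, OfNat.ofNat_ne_zero, false_or,
    Finset.mem_univ, true_implies, imp_false, ne_eq]

lemma isOrientedGraph_iff (c : DirectedConfiguration n r) :
    c.toMultidigraph.IsOrientedGraph ↔ (orientedPattern n r).weight c = 0 := by
  rw [Multidigraph.IsOrientedGraph, Multidigraph.IsSimple, loopless_iff, noParallelArcs_iff,
    digonFree_iff, weight_orientedPattern_eq_zero_iff, and_assoc]
  refine and_congr_right fun hloop =>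
    ⟨?_, fun hclash => ⟨fun u w h₁ h₂ => ?_, fun u w hu h₁ h₂ => ?_⟩⟩
  · rintro ⟨hpar, hdig⟩ u w ⟨hu, huw, -, ⟨h₁, h₂⟩ | ⟨h₁, h₂⟩⟩
    · exact huw (hpar u w h₁ h₂)
    · exact hdig u w hu h₁ h₂
  · by_contra huw
    exact hclash u w ⟨hloop u, huw, c.injective.ne huw, .inl ⟨h₁, h₂⟩⟩
  · have huw : u ≠ w := by rintro rfl; exact hu h₁
    exact hclash u w ⟨hu, huw, c.injective.ne huw, .inr ⟨h₁, h₂⟩⟩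

lemma model_real_isOrientedGraph (n r : ℕ) :
    (directedConfigurationModel n r).toMeasure.real
      {D : Multidigraph (Fin n) | D.IsOrientedGraph} = (orientedPattern n r).avoidProb := by
  classical
  rw [Measure.real, PMF.toMeasure_apply_eq_toOuterMeasure_apply _ MeasurableSpace.measurableSet_top,
    directedConfigurationModel, PMF.toOuterMeasure_map_apply,
    PMF.toOuterMeasure_uniformOfFintype_apply, ENNReal.toReal_div, ENNReal.toReal_natCast,
    ENNReal.toReal_natCast, ForbiddenPattern.avoidProb, Fintype.expect_eq_sum_div_card,
    Finset.sum_boole, Fintype.card_subtype]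
  simp only [Set.mem_preimage, Set.mem_ofPred_eq, isOrientedGraph_iff]

end DirectedConfiguration

theorem lemma4p1 (r : ℕ) (hr : 0 < r) :
    Tendsto
      (fun n : ℕ =>
        (directedConfigurationModel n r).toMeasure.real
          {D : Multidigraph (Fin n) | D.IsOrientedGraph})
      atTop (𝓝 (Real.exp (-cycleMean r 1 - cycleMean r 2))) := by
  have hcard : Tendsto (fun n => Fintype.card (Fin n × Fin r)) atTop atTop := by
    simpa only [Fintype.card_prod, Fintype.card_fin, id] using tendsto_id.atTop_mul_const' hr
  have hmean : (2 * (r : ℝ) + ((r - 1) ^ 2 + r ^ 2 : ℕ)) / 2 = cycleMean r 1 + cycleMean r 2 := by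
    simp only [cycleMean, Nat.cast_add, Nat.cast_pow, Nat.cast_sub hr, Nat.cast_one, Nat.cast_two]
    ring
  simp only [DirectedConfiguration.model_real_isOrientedGraph]
  rw [← neg_add', ← hmean]
  exact ForbiddenPattern.tendsto_avoidProb (DirectedConfiguration.orientedPattern · r) hcard
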